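/- Let $K$ be an algebraically closed field, let $n\ge 1$, let $\mathbb N=\{0,1,2,\dots\}$, and let $e_1,\dots,e_n$ be the canonical basis of $\mathbb Z^n$. For $P=\sum_i a_iX^i\in K[X_1,\dots,X_n]$ (where $X^i=X_1^{i_1}\cdots X_n^{i_n}$) the support of $P$ is the set of all $i\in\mathbb N^n$ with $a_i\ne 0$, and $P$ is called reducible if $P=QR$ for some non-constant $Q,R\in K[X_1,\dots,X_n]$. For a finite nonempty set $I\subset\mathbb N^n$ let $V_I$ be the set of all $P\in K[X_1,\dots,X_n]$ with support exactly $I$, and let $Z_I$ be the set of all reducible $P\in V_I$. Theorem. Let $I\subset\mathbb N^n$ be finite and nonempty. Then $Z_I=V_I$ (that is, every polynomial with support exactly $I$ is reducible) if and only if at least one of the following holds: (i) there is $t\in\{1,\dots,n\}$ such that $I\subseteq e_t+\mathbb N^n$ and $I\ne\{e_t\}$; (ii) there are $i=(i_1,\dots,i_n)$ and $j=(j_1,\dots,j_n)$ in $I$ with $i_tj_t=0$ for all $t$ and $\gcd(i_1,\dots,i_n,j_1,\dots,j_n)>1$ such that $I\subseteq[i,j]:=\{(1-\lambda)i+\lambda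 j\mid \lambda\in\mathbb R,\ 0\le\lambda\le1\}$ (with the convention $\gcd(0,\dots,0)=0$); (iii) there is a prime $p$ such that $\operatorname{char}K=p$, $I\subseteq p\mathbb N^n$ and $I\ne\{0\}$. -/

import Mathlib

/-- `V_I(K)`: the polynomials `P ∈ K[X₁, …, Xₙ]` whose support is exactly `I`. -/
def polysWithSupport (K : Type*) [Field K] {n : ℕ} (I : Finset (Fin n →₀ ℕ)) :
    Set (MvPolynomial (Fin n) K) :=
  {P | P.support = I}

/-- A polynomial is reducible (decomposable) if it is a product of two non-constant polynomials.
In particular constants are not reducible. -/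
def IsReduciblePoly {K : Type*} [Field K] {n : ℕ} (P : MvPolynomial (Fin n) K) : Prop :=
  ∃ Q R : MvPolynomial (Fin n) K,
    (∀ c : K, Q ≠ MvPolynomial.C c) ∧ (∀ c : K, R ≠ MvPolynomial.C c) ∧ P = Q * R

/-- `Z_I(K)`: the reducible polynomials in `V_I(K)`. -/
def reduciblePolysWithSupport (K : Type*) [Field K] {n : ℕ} (I : Finset (Fin n →₀ ℕ)) :
    Set (MvPolynomial (Fin n) K) :=
  {P | P ∈ polysWithSupport K I ∧ IsReduciblePoly P}

/-- An exponent vector in `ℕⁿ`, seen as a point of `ℝⁿ`. -/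
def exponentToReal {n : ℕ} (k : Fin n →₀ ℕ) : Fin n → ℝ := fun t => (k t : ℝ)

/-!
Call a polynomial *Laurent irreducible* if in each of its factorizations one factor is a monomial
(`OnlyMonomialFactors`). If, for every variable `X_t`, the support contains an exponent `k` with
`k t = 0`, such a polynomial is not a product of two non-constant ones. So the point is to produce,
when none of the three conditions holds, a Laurent irreducible polynomial with support `I`. The
basic tool is that the maximum of an additive functional over supports is additive under products.

If the exponents in `I` lie on a line, the excluded conditions leave only `I = {i, j}` with `j - i`
primitive, and the supports of two non-monomial factors would together be too long
(`onlyMonomialFactors_of_primitive_binomial`).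

Otherwise there are non-collinear `i, j, k` in `I` with `i - j` nonzero modulo the characteristic.
The trinomial `X^i - X^j + X^k` is Laurent irreducible by an Eisenstein argument modulo `ε²`,
carried out with an Euler operator (`onlyMonomialFactors_trinomial`). The remaining exponents are
added one at a time (`OnlyMonomialFactors.exists_add_monomial`). If `P + c X^k` factored
nontrivially for every nonzero `c`, it would do so over an ultrapower of `K`, with `c`
transcendental over `K`; reducing at a valuation with `c ↦ 0` gives a factorization of `P` over an
extension of `K`, in which one factor, say the second, becomes a monomial `X^r` because `P` is
Laurent irreducible over every extension (`OnlyMonomialFactors.map`). If the second factor had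
another exponent `r'`, each functional positive on `r' - r` would be maximal only at `k` on the
enlarged support, so every difference between `k` and an exponent of `P` would be parallel to
`r' - r`, and the support of `P` would be collinear (`subsingleton_support_of_translate`).

Conversely, under the three conditions a polynomial is respectively divisible by a variable, a
binary form of degree at least two in two monomials, or a `p`-th power.
-/

open MvPolynomial

/-! ### Additive functionals on supports of products -/

/-- Exponents at which an additive functional is maximal on the two supports contribute to the
product without cancellation, since exponent monoids have unique sums. -/
theorem exists_mem_support_mul_le {R G Γ : Type*} [Semiring R] [NoZeroDivisors R] [AddZeroClass G]
    [UniqueSums G] [AddCommMonoid Γ] [LinearOrder Γ] [IsOrderedCancelAddMonoid Γ]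
    (L : G →+ Γ) {x y : AddMonoidAlgebra R G} {a b : G}
    (ha : a ∈ x.coeff.support) (hb : b ∈ y.coeff.support) :
    ∃ c ∈ (x * y).coeff.support, L a + L b ≤ L c := by
  classical
  obtain ⟨a₁, ha₁, hmaxa⟩ := Finset.exists_max_image x.coeff.support L ⟨a, ha⟩
  obtain ⟨b₁, hb₁, hmaxb⟩ := Finset.exists_max_image y.coeff.support L ⟨b, hb⟩
  obtain ⟨a₀, ha₀, b₀, hb₀, huniq⟩ := UniqueSums.uniqueAdd_of_nonempty
    (A := x.coeff.support.filter fun g => L g = L a₁)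
    (B := y.coeff.support.filter fun g => L g = L b₁)
    ⟨a₁, by simpa using ha₁⟩ ⟨b₁, by simpa using hb₁⟩
  rw [Finset.mem_filter] at ha₀ hb₀
  have hu : UniqueAdd x.coeff.support y.coeff.support a₀ b₀ := by
    intro g h hg hh hgh
    have hsum : L g + L h = L a₁ + L b₁ := by
      rw [← map_add, hgh, map_add, ha₀.2, hb₀.2]
    have h1 := hmaxa g hg
    have h2 := hmaxb h hh
    have h3 : L g = L a₁ := by
      refine le_antisymm h1 (le_of_not_gt fun hlt => ?_)
      exact absurd hsum (add_lt_add_of_lt_of_le hlt h2).ne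
    have h4 : L h = L b₁ := by
      refine le_antisymm h2 (le_of_not_gt fun hlt => ?_)
      exact absurd hsum (add_lt_add_of_le_of_lt h1 hlt).ne
    exact huniq (Finset.mem_filter.2 ⟨hg, h3⟩) (Finset.mem_filter.2 ⟨hh, h4⟩) hgh
  refine ⟨a₀ + b₀, ?_, ?_⟩
  · rw [Finsupp.mem_support_iff, AddMonoidAlgebra.coeff_mul_add_of_uniqueAdd hu]
    exact mul_ne_zero (Finsupp.mem_support_iff.1 ha₀.1) (Finsupp.mem_support_iff.1 hb₀.1)
  · rw [map_add, ha₀.2, hb₀.2]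
    exact add_le_add (hmaxa a ha) (hmaxb b hb)

section

variable {σ K : Type*} [Field K]

theorem MvPolynomial.exists_mem_support_mul_le {Γ : Type*} [AddCommMonoid Γ] [LinearOrder Γ]
    [IsOrderedCancelAddMonoid Γ] (L : (σ →₀ ℕ) →+ Γ) {Q R : MvPolynomial σ K} {a b : σ →₀ ℕ}
    (ha : a ∈ Q.support) (hb : b ∈ R.support) :
    ∃ c ∈ (Q * R).support, L a + L b ≤ L c :=
  _root_.exists_mem_support_mul_le L ha hb

theorem MvPolynomial.exists_mem_support_mul_ge (L : (σ →₀ ℕ) →+ ℤ) {Q R : MvPolynomial σ K}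
    {a b : σ →₀ ℕ} (ha : a ∈ Q.support) (hb : b ∈ R.support) :
    ∃ c ∈ (Q * R).support, L c ≤ L a + L b := by
  obtain ⟨c, hc, h⟩ := MvPolynomial.exists_mem_support_mul_le (-L) ha hb
  exact ⟨c, hc, by simp only [AddMonoidHom.neg_apply] at h; linarith⟩

/-- The exponent of the variable `X_t`, as an additive functional with integer values. -/
noncomputable def exponentAt (t : σ) : (σ →₀ ℕ) →+ ℤ :=
  (Nat.castAddMonoidHom ℤ).comp (Finsupp.applyAddHom t)

@[simp]
theorem exponentAt_apply (t : σ) (m : σ →₀ ℕ) : exponentAt t m = (m t : ℤ) := rfl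

theorem eq_of_exponentAt_eq {a b : σ →₀ ℕ} (h : ∀ t, exponentAt t a = exponentAt t b) : a = b :=
  Finsupp.ext fun t => by simpa using h t

/-- `P` has only trivial factorizations up to monomials: whenever `P = Q R`, one of the factors has
at most one term. For `P ≠ 0` this says that `P` is irreducible or a unit in the ring of Laurent
polynomials, expressed without leaving `K[X]`. -/
def OnlyMonomialFactors (P : MvPolynomial σ K) : Prop :=
  ∀ Q R : MvPolynomial σ K, P = Q * R →
    (Q.support : Set (σ →₀ ℕ)).Subsingleton ∨ (R.support : Set (σ →₀ ℕ)).Subsingleton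

/-- Exponents lie on a common affine line: all `2 × 2` minors of pairs of differences vanish. -/
def ExponentsCollinear (S : Finset (σ →₀ ℕ)) : Prop :=
  ∀ i ∈ S, ∀ j ∈ S, ∀ k ∈ S, ∀ s t : σ,
    ((j s : ℤ) - i s) * ((k t : ℤ) - i t) = ((j t : ℤ) - i t) * ((k s : ℤ) - i s)

/-! ### Binomials with primitive exponent difference -/

/-- A functional that is constant on the support of a product of nonzero polynomials is constant on
the support of each factor. -/
theorem functional_const_on_factor (L : (σ →₀ ℕ) →+ ℤ) {Q R : MvPolynomial σ K} (hR : R ≠ 0)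
    {v : ℤ} (h : ∀ c ∈ (Q * R).support, L c = v) {a a' : σ →₀ ℕ} (ha : a ∈ Q.support)
    (ha' : a' ∈ Q.support) : L a = L a' := by
  obtain ⟨b, hb⟩ := (support_nonempty (p := R)).2 hR
  obtain ⟨c₁, h₁, h₁'⟩ := MvPolynomial.exists_mem_support_mul_le L ha hb
  obtain ⟨c₂, h₂, h₂'⟩ := MvPolynomial.exists_mem_support_mul_ge L ha hb
  obtain ⟨c₃, h₃, h₃'⟩ := MvPolynomial.exists_mem_support_mul_le L ha' hb
  obtain ⟨c₄, h₄, h₄'⟩ := MvPolynomial.exists_mem_support_mul_ge L ha' hb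
  rw [h c₁ h₁] at h₁'
  rw [h c₂ h₂] at h₂'
  rw [h c₃ h₃] at h₃'
  rw [h c₄ h₄] at h₄'
  linarith

theorem exponent_diff_parallel_of_binomial {i j : σ →₀ ℕ} {Q R : MvPolynomial σ K} (hR : R ≠ 0)
    (hP : ∀ c ∈ (Q * R).support, c = i ∨ c = j) {a a' : σ →₀ ℕ} (ha : a ∈ Q.support) (ha' : a' ∈ Q.support)
    (s t : σ) :
    ((a' s : ℤ) - a s) * ((j t : ℤ) - i t) = ((a' t : ℤ) - a t) * ((j s : ℤ) - i s) := by
  have h := functional_const_on_factor (((j t : ℤ) - i t) • exponentAt s -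
    ((j s : ℤ) - i s) • exponentAt t) hR (v := ((j t : ℤ) - i t) * i s - ((j s : ℤ) - i s) * i t)
    (fun c hc => by
      rcases hP c hc with rfl | rfl
      · simp
      · simp
        ring) ha ha'
  simp at h
  linarith

/-- If `j - i` is a primitive vector, a polynomial with support `{i, j}` has only monomial factors:
the supports of both factors consist of points spaced by multiples of `j - i`, and their lengths
add up to a single step. -/
theorem onlyMonomialFactors_of_primitive_binomial [Fintype σ] {i j : σ →₀ ℕ}
    {P : MvPolynomial σ K} (hP : ∀ c ∈ P.support, c = i ∨ c = j) (hP0 : P ≠ 0) (z : σ → ℤ)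
    (hz : ∑ t, z t * ((j t : ℤ) - i t) = 1) : OnlyMonomialFactors P := by
  rintro Q R rfl
  have hQ0 : Q ≠ 0 := left_ne_zero_of_mul hP0
  have hR0 : R ≠ 0 := right_ne_zero_of_mul hP0
  let Z : (σ →₀ ℕ) →+ ℤ := ∑ t, z t • exponentAt t
  have hZ : ∀ m, Z m = ∑ t, z t * (m t : ℤ) := fun m => by simp [Z, AddMonoidHom.finsetSum_apply]
  have hZij : Z j - Z i = 1 := by
    rw [hZ, hZ, ← Finset.sum_sub_distrib, ← hz]
    exact Finset.sum_congr rfl fun t _ => by ring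
  -- By Bezout, two points of a support with the same value of `Z` coincide.
  have key : ∀ {Q R : MvPolynomial σ K}, R ≠ 0 → (∀ c ∈ (Q * R).support, c = i ∨ c = j) → ∀ {a a'},
      a ∈ Q.support → a' ∈ Q.support → Z a = Z a' → a = a' := by
    intro Q R hR h a a' ha ha' hZa
    refine eq_of_exponentAt_eq fun t => ?_
    have h1 : ((a' t : ℤ) - a t) * ∑ s, z s * ((j s : ℤ) - i s) =
        (∑ s, z s * ((a' s : ℤ) - a s)) * ((j t : ℤ) - i t) := by
      rw [Finset.mul_sum, Finset.sum_mul]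
      refine Finset.sum_congr rfl fun s _ => ?_
      linear_combination -(z s) * exponent_diff_parallel_of_binomial hR h ha ha' s t
    have h2 : ∑ s, z s * ((a' s : ℤ) - a s) = 0 := by
      rw [← sub_eq_zero.2 hZa.symm, hZ, hZ, ← Finset.sum_sub_distrib]
      exact Finset.sum_congr rfl fun s _ => by ring
    rw [hz, h2] at h1
    simp only [exponentAt_apply]
    linarith
  by_contra! hcon
  obtain ⟨hQ, hR⟩ := hcon
  have width : ∀ {Q R : MvPolynomial σ K}, R ≠ 0 → (∀ c ∈ (Q * R).support, c = i ∨ c = j) →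
      (Q.support : Set (σ →₀ ℕ)).Nontrivial →
      ∃ a ∈ Q.support, ∃ a' ∈ Q.support, Z a + 1 ≤ Z a' := by
    rintro Q R hR h ⟨a, ha, a', ha', hne⟩
    rcases lt_trichotomy (Z a) (Z a') with hlt | heq | hgt
    · exact ⟨a, ha, a', ha', hlt⟩
    · exact absurd (key hR h ha ha' heq) hne
    · exact ⟨a', ha', a, ha, hgt⟩
  obtain ⟨a, ha, a', ha', haa⟩ := width hR0 hP hQ
  obtain ⟨b, hb, b', hb', hbb⟩ := width hQ0 (by rwa [mul_comm]) hR
  obtain ⟨c, hc, hc'⟩ := MvPolynomial.exists_mem_support_mul_ge Z ha hb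
  obtain ⟨d, hd, hd'⟩ := MvPolynomial.exists_mem_support_mul_le Z ha' hb'
  rcases hP c hc with rfl | rfl <;> rcases hP d hd with rfl | rfl <;> linarith

/-! ### Trinomials with non-collinear exponents -/

theorem AddMonoidAlgebra.eq_single_of_mul_eq_single {x y : AddMonoidAlgebra K ℤ} {g : ℤ}
    (h : x * y = .single g 1) : ∃ s q, q ≠ 0 ∧ x = .single s q := by
  have h0 : x * y ≠ 0 := by
    rw [h]
    exact fun h => one_ne_zero (AddMonoidAlgebra.single_eq_zero.1 h)
  obtain ⟨s, hs⟩ : x.coeff.support.Nonempty := by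
    rw [Finsupp.support_nonempty_iff]
    exact fun hx => left_ne_zero_of_mul h0 (AddMonoidAlgebra.coeff_injective hx)
  obtain ⟨u, hu⟩ : y.coeff.support.Nonempty := by
    rw [Finsupp.support_nonempty_iff]
    exact fun hy => right_ne_zero_of_mul h0 (AddMonoidAlgebra.coeff_injective hy)
  have hsub : ∀ c ∈ (x * y).coeff.support, c = g := by
    intro c hc
    rw [h] at hc
    exact Finset.mem_singleton.1 (Finsupp.support_single_subset hc)
  have hall : ∀ a ∈ x.coeff.support, a + u = g := by
    intro a ha
    obtain ⟨c, hc, h1⟩ := exists_mem_support_mul_le (AddMonoidHom.id ℤ) ha hu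
    obtain ⟨d, hd, h2⟩ := exists_mem_support_mul_le (-AddMonoidHom.id ℤ) ha hu
    rw [hsub c hc] at h1
    rw [hsub d hd] at h2
    simp only [AddMonoidHom.id_apply, AddMonoidHom.neg_apply] at h1 h2
    linarith
  refine ⟨s, x.coeff s, Finsupp.mem_support_iff.1 hs, AddMonoidAlgebra.coeff_injective ?_⟩
  refine Finsupp.support_subset_singleton.1 fun a ha => ?_
  rw [Finset.mem_singleton]
  linarith [hall a ha, hall s hs]

/-- If the first factor of a polynomial supported on `i, j, k`, with `L i = L j < L k`, has full
`L`-width, then the second factor is a monomial: it has constant `L`-value, and its product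
with the top `L`-level of the first factor is the monomial with exponent `k`. -/
theorem subsingleton_support_of_full_width {i j k : σ →₀ ℕ} (L : (σ →₀ ℕ) →+ ℤ)
    (hij : L i = L j) (hk : L i < L k) {Q R : MvPolynomial σ K}
    (hmem : ∀ c ∈ (Q * R).support, c = i ∨ c = j ∨ c = k) {m m' : σ →₀ ℕ} (hm : m ∈ Q.support) (hm' : m' ∈ Q.support)
    (hmm : L m' - L m = L k - L i) : (R.support : Set (σ →₀ ℕ)).Subsingleton := by
  have hconst : ∀ b ∈ R.support, L m' + L b = L k := by
    intro b hb
    obtain ⟨c, hc, h1⟩ := MvPolynomial.exists_mem_support_mul_le L hm' hb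
    obtain ⟨d, hd, h2⟩ := MvPolynomial.exists_mem_support_mul_ge L hm hb
    have h3 : L c ≤ L k := by rcases hmem c hc with rfl | rfl | rfl <;> linarith
    have h4 : L i ≤ L d := by rcases hmem d hd with rfl | rfl | rfl <;> linarith
    linarith
  -- Refining `L` lexicographically by `M` singles out the exponent `k`.
  have hlex : ∀ (M : (σ →₀ ℕ) →+ ℤ), ∀ b ∈ R.support, M m' + M b ≤ M k := by
    intro M b hb
    let N : (σ →₀ ℕ) →+ (ℤ ×ₗ ℤ) :=
      { toFun := fun m => toLex (L m, M m)
        map_zero' := by simp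
        map_add' := fun x y => by simp [← toLex_add] }
    obtain ⟨c, hc, h1⟩ := MvPolynomial.exists_mem_support_mul_le N hm' hb
    have h2 : toLex (L m' + L b, M m' + M b) ≤ toLex (L c, M c) := h1
    rw [Prod.Lex.toLex_le_toLex, hconst b hb] at h2
    simp only at h2
    rcases hmem c hc with rfl | rfl | rfl
    · rcases h2 with h2 | h2 <;> omega
    · rcases h2 with h2 | h2 <;> omega
    · rcases h2 with h2 | h2 <;> omega
  intro b hb b' hb'
  refine eq_of_exponentAt_eq fun t => ?_
  have h1 := hlex (exponentAt t) b hb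
  have h2 := hlex (exponentAt t) b' hb'
  have h3 := hlex (-exponentAt t) b hb
  have h4 := hlex (-exponentAt t) b' hb'
  simp only [AddMonoidHom.neg_apply] at h3 h4
  linarith

theorem MvPolynomial.coeff_X_mul_pderiv (t : σ) (Q : MvPolynomial σ K) (m : σ →₀ ℕ) :
    coeff m (X t * pderiv t Q) = (m t : K) * coeff m Q := by
  classical
  induction Q using MvPolynomial.induction_on' with
  | monomial u a =>
    rw [X_mul_pderiv_monomial, coeff_smul, coeff_monomial]
    split_ifs with h
    · rw [h, nsmul_eq_mul]
    · simp
  | add p q hp hq => rw [map_add, mul_add, coeff_add, hp, hq, coeff_add, mul_add]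

/-- The ring homomorphism `X^m ↦ y^(L m)` to Laurent polynomials in one variable `y`. -/
noncomputable def gradeHom (L : (σ →₀ ℕ) →+ ℤ) : MvPolynomial σ K →+* AddMonoidAlgebra K ℤ :=
  AddMonoidAlgebra.mapDomainRingHom K L

theorem gradeHom_monomial (L : (σ →₀ ℕ) →+ ℤ) (m : σ →₀ ℕ) (c : K) :
    gradeHom L (monomial m c) = .single (L m) c :=
  AddMonoidAlgebra.mapDomain_single

theorem exists_mem_support_of_gradeHom {L : (σ →₀ ℕ) →+ ℤ} {Q : MvPolynomial σ K} {g : ℤ}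
    (h : (gradeHom L Q).coeff g ≠ 0) : ∃ m ∈ Q.support, L m = g := by
  classical
  have h' : g ∈ (Finsupp.mapDomain L (AddMonoidAlgebra.coeff Q)).support := Finsupp.mem_support_iff.2 h
  exact Finset.mem_image.1 (Finsupp.mapDomain_support h')

theorem onlyMonomialFactors_trinomial_of_lt {i j k : σ →₀ ℕ} {t : σ} (ht : (i t : K) ≠ j t)
    (L : (σ →₀ ℕ) →+ ℤ) (hij : L i = L j) (hk : L i < L k) :
    OnlyMonomialFactors (monomial i (1 : K) - monomial j 1 + monomial k 1) := by
  classical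
  intro Q R hP
  have hsupp : ∀ c ∈ (Q * R).support, c = i ∨ c = j ∨ c = k := by
    rw [← hP]
    intro c hc
    by_contra hne
    simp only [not_or] at hne
    rw [mem_support_iff, coeff_add, coeff_sub, coeff_monomial, coeff_monomial, coeff_monomial,
      if_neg (Ne.symm hne.1), if_neg (Ne.symm hne.2.1), if_neg (Ne.symm hne.2.2)] at hc
    simp at hc
  have hφ : gradeHom L Q * gradeHom L R = .single (L k) 1 := by
    rw [← map_mul, ← hP, map_add, map_sub, gradeHom_monomial, gradeHom_monomial,
      gradeHom_monomial, hij, sub_self, zero_add]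
  obtain ⟨s, q, hq, hsq⟩ := AddMonoidAlgebra.eq_single_of_mul_eq_single hφ
  obtain ⟨u, r, hr, hur⟩ := AddMonoidAlgebra.eq_single_of_mul_eq_single
    ((mul_comm _ _).trans hφ)
  have hsu : s + u = L k := by
    rw [hsq, hur, AddMonoidAlgebra.single_mul_single] at hφ
    have h1 := congrArg (fun x => x.coeff (s + u)) hφ
    simp only [AddMonoidAlgebra.coeff_single, Finsupp.single_eq_same] at h1
    by_contra hne
    rw [Finsupp.single_eq_of_ne hne] at h1
    exact mul_ne_zero hq hr h1
  -- The Euler operator `X_t ∂/∂X_t` is the first-order part of the deformation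
  -- `X_t ↦ (1 + ε) X_t`; modulo `ε²` the trinomial is of Eisenstein type.
  have hE : gradeHom L (X t * pderiv t Q) * .single u r +
      .single s q * gradeHom L (X t * pderiv t R) =
      .single (L i) (i t : K) - .single (L i) (j t : K) + .single (L k) (k t : K) := by
    have h1 : X t * pderiv t (Q * R) =
        X t * pderiv t Q * R + Q * (X t * pderiv t R) := by
      rw [Derivation.leibniz, smul_eq_mul, smul_eq_mul]
      ring
    rw [← hsq, ← hur, ← map_mul, ← map_mul, ← map_add, ← h1, ← hP, map_add, map_sub, mul_add,
      mul_sub, X_mul_pderiv_monomial, X_mul_pderiv_monomial, X_mul_pderiv_monomial, ← map_nsmul,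
      ← map_nsmul, ← map_nsmul, nsmul_one, nsmul_one, nsmul_one, map_add, map_sub,
      gradeHom_monomial, gradeHom_monomial, gradeHom_monomial, hij]
  have hcoeff := congrArg (fun x => x.coeff (L i)) hE
  simp only [AddMonoidAlgebra.coeff_add, AddMonoidAlgebra.coeff_sub, Finsupp.add_apply,
    Finsupp.sub_apply, AddMonoidAlgebra.coeff_mul_single_apply,
    AddMonoidAlgebra.coeff_single_mul_apply, AddMonoidAlgebra.coeff_single,
    Finsupp.single_eq_same, Finsupp.single_eq_of_ne hk.ne, add_zero] at hcoeff
  have hsQ : ∃ m ∈ Q.support, L m = s :=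
    exists_mem_support_of_gradeHom (by
      rwa [hsq, AddMonoidAlgebra.coeff_single, Finsupp.single_eq_same])
  have huR : ∃ m ∈ R.support, L m = u :=
    exists_mem_support_of_gradeHom (by
      rwa [hur, AddMonoidAlgebra.coeff_single, Finsupp.single_eq_same])
  have hEsupp : ∀ {Q : MvPolynomial σ K} {m}, m ∈ (X t * pderiv t Q).support → m ∈ Q.support := by
    intro Q m hm
    rw [mem_support_iff, MvPolynomial.coeff_X_mul_pderiv] at hm
    exact mem_support_iff.2 (right_ne_zero_of_mul hm)
  rcases ne_or_eq ((gradeHom L (X t * pderiv t Q)).coeff (L i + -u)) 0 with h | h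
  · right
    obtain ⟨m, hm, hLm⟩ := exists_mem_support_of_gradeHom h
    obtain ⟨m', hm', hLm'⟩ := hsQ
    exact subsingleton_support_of_full_width L hij hk hsupp (hEsupp hm) hm' (by linarith)
  · left
    rw [h, zero_mul, zero_add] at hcoeff
    have h' : (gradeHom L (X t * pderiv t R)).coeff (-s + L i) ≠ 0 := by
      intro h'
      rw [h', mul_zero] at hcoeff
      exact sub_ne_zero.2 ht hcoeff.symm
    obtain ⟨m, hm, hLm⟩ := exists_mem_support_of_gradeHom h'
    obtain ⟨m', hm', hLm'⟩ := huR
    rw [mul_comm] at hsupp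
    exact subsingleton_support_of_full_width L hij hk hsupp (hEsupp hm) hm' (by linarith)

/-- The trinomial `X^i - X^j + X^k` has only monomial factors when its exponents are not collinear
and `i - j` is nonzero in `K`. -/
theorem onlyMonomialFactors_trinomial {i j k : σ →₀ ℕ} {t : σ} (ht : (i t : K) ≠ j t)
    (hcol : ∃ s t, ((j s : ℤ) - i s) * ((k t : ℤ) - i t) ≠ ((j t : ℤ) - i t) * ((k s : ℤ) - i s)) :
    OnlyMonomialFactors (monomial i (1 : K) - monomial j 1 + monomial k 1) := by
  obtain ⟨a, b, hab⟩ := hcol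
  -- The minor of `j - i` against a varying second vector, evaluated on exponents.
  let L : (σ →₀ ℕ) →+ ℤ := ((j a : ℤ) - i a) • exponentAt b - ((j b : ℤ) - i b) • exponentAt a
  have hL : ∀ m, L m = ((j a : ℤ) - i a) * m b - ((j b : ℤ) - i b) * m a := fun m => by simp [L]
  have hij : L i = L j := by
    rw [hL, hL]
    ring
  have hk : L i ≠ L k := by
    rw [hL, hL]
    intro h
    exact hab (by linear_combination -h)
  rcases lt_or_gt_of_ne hk with h | h
  · exact onlyMonomialFactors_trinomial_of_lt ht L hij h
  · exact onlyMonomialFactors_trinomial_of_lt ht (-L) (by simp [hij]) (by simpa using h)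

/-! ### Enlarging the support by one exponent: the convexity argument -/

/-- Suppose the support of `Q R` lies in `J ∪ {k}` with `J` not collinear, and the support of `Q`
contains `J - r` for some `r` in the support of `R`. Then `R` is a monomial: for another exponent
`r'` of `R`, every functional positive on `r' - r` attains its maximum on `J ∪ {k}` at `k` only,
which forces every `k - j` to be parallel to `r' - r`. -/
theorem subsingleton_support_of_translate {J : Finset (σ →₀ ℕ)} (hJ : ¬ ExponentsCollinear J)
    {k : σ →₀ ℕ} {Q R : MvPolynomial σ K} (hP : ∀ c ∈ (Q * R).support, c ∈ J ∨ c = k)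
    {r : σ →₀ ℕ} (hQ : ∀ j ∈ J, ∃ a ∈ Q.support, a + r = j) :
    ∀ r' ∈ R.support, r' = r := by
  intro r' hr'
  by_contra hne
  apply hJ
  have hdom : ∀ L : (σ →₀ ℕ) →+ ℤ, L r < L r' → ∀ j ∈ J, L j < L k := by
    intro L hL j hj
    obtain ⟨j₀, hj₀, hmax⟩ := Finset.exists_max_image J L ⟨j, hj⟩
    obtain ⟨a, ha, rfl⟩ := hQ j₀ hj₀
    obtain ⟨c, hc, hle⟩ := MvPolynomial.exists_mem_support_mul_le L ha hr'
    have h1 := hmax j hj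
    rw [map_add] at h1
    rcases hP c hc with hcJ | rfl
    · have h2 := hmax c hcJ
      rw [map_add] at h2
      linarith
    · linarith
  have hpar : ∀ j ∈ J, ∀ s t : σ,
      ((r' s : ℤ) - r s) * ((k t : ℤ) - j t) = ((r' t : ℤ) - r t) * ((k s : ℤ) - j s) := by
    intro j hj s t
    let L : (σ →₀ ℕ) →+ ℤ := ((k t : ℤ) - j t) • exponentAt s - ((k s : ℤ) - j s) • exponentAt t
    have hL : ∀ m, L m = ((k t : ℤ) - j t) * m s - ((k s : ℤ) - j s) * m t :=
      fun m => by simp [L]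
    have hjk : L j = L k := by
      rw [hL, hL]
      ring
    have h1 : ¬ L r < L r' := fun h => (hdom L h j hj).ne hjk
    have h2 : ¬ (-L) r < (-L) r' := fun h => (hdom (-L) h j hj).ne (by simp [hjk])
    simp only [AddMonoidHom.neg_apply, neg_lt_neg_iff] at h2
    have h3 := le_antisymm (not_lt.1 h1) (not_lt.1 h2)
    rw [hL, hL] at h3
    linear_combination h3
  obtain ⟨a, ha⟩ : ∃ a, (r' a : ℤ) - r a ≠ 0 := by
    by_contra! h
    exact hne (Finsupp.ext fun t => by have := h t; omega)
  intro i hi j hj l hl s t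
  apply mul_left_cancel₀ (mul_ne_zero ha ha)
  have e : ∀ j ∈ J, ∀ s, ((r' a : ℤ) - r a) * ((j s : ℤ) - i s) =
      ((r' s : ℤ) - r s) * ((j a : ℤ) - i a) := fun j hj s => by
    linear_combination hpar i hi a s - hpar j hj a s
  have e1 := e j hj s
  have e2 := e j hj t
  have e3 := e l hl s
  have e4 := e l hl t
  calc _ = (((r' a : ℤ) - r a) * ((j s : ℤ) - i s)) * (((r' a : ℤ) - r a) * ((l t : ℤ) - i t)) := by
        ring
    _ = (((r' a : ℤ) - r a) * ((j t : ℤ) - i t)) * (((r' a : ℤ) - r a) * ((l s : ℤ) - i s)) := by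
        rw [e1, e2, e3, e4]
        ring
    _ = _ := by ring

/-! ### Extension of the base field -/

/-- A finitely generated nontrivial algebra over an algebraically closed field has a rational
point. -/
theorem exists_ringHom_of_finiteType [IsAlgClosed K] (B : Type*) [CommRing B] [Nontrivial B]
    [Algebra K B] [Algebra.FiniteType K B] :
    ∃ φ : B →+* K, φ.comp (algebraMap K B) = RingHom.id K := by
  obtain ⟨m, hm⟩ := Ideal.exists_maximal B
  let _ : Field (B ⧸ m) := Ideal.Quotient.field m
  have : Algebra.FiniteType K (B ⧸ m) :=
    Algebra.FiniteType.of_surjective (Ideal.Quotient.mkₐ K m) (Ideal.Quotient.mkₐ_surjective K m)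
  have : Module.Finite K (B ⧸ m) :=
    finite_of_algHom_finiteType_of_isJacobsonRing (AlgHom.id K (B ⧸ m))
  let e := RingEquiv.ofBijective (algebraMap K (B ⧸ m))
    IsAlgClosed.algebraMap_bijective_of_isIntegral
  refine ⟨(e.symm : B ⧸ m →+* K).comp (Ideal.Quotient.mk m), RingHom.ext fun x => ?_⟩
  exact e.symm_apply_apply x

/-- Over an algebraically closed field, having only monomial factors is invariant under extension of
the base field: a nontrivial factorization over an extension specializes, by the Nullstellensatz,
to one over `K` in which prescribed coefficients remain nonzero. -/
theorem OnlyMonomialFactors.map [IsAlgClosed K] {F : Type*} [Field F] [Algebra K F]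
    {P : MvPolynomial σ K} (hP : OnlyMonomialFactors P) :
    OnlyMonomialFactors (MvPolynomial.map (algebraMap K F) P) := by
  classical
  intro Q R hQR
  by_contra! hcon
  obtain ⟨⟨a, ha, a', ha', hne⟩, ⟨b, hb, b', hb', hne'⟩⟩ := hcon
  let S : Finset F := (Q.support.image fun m => coeff m Q) ∪ (R.support.image fun m => coeff m R) ∪
    ((Q.support.image fun m => (coeff m Q)⁻¹) ∪ (R.support.image fun m => (coeff m R)⁻¹))
  let B : Subalgebra K F := Algebra.adjoin K (S : Set F)
  have hS : ∀ x ∈ S, x ∈ B := fun x hx => Algebra.subset_adjoin hx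
  have : Algebra.FiniteType K B := (Subalgebra.fg_iff_finiteType B).1 ⟨S, rfl⟩
  obtain ⟨φ, hφ⟩ := exists_ringHom_of_finiteType (K := K) B
  let ι : B →+* F := B.val.toRingHom
  have hι : Function.Injective ι := Subtype.val_injective
  have lift : ∀ Q : MvPolynomial σ F, (∀ m ∈ Q.support, coeff m Q ∈ S ∧ (coeff m Q)⁻¹ ∈ S) →
      ∃ Q' : MvPolynomial σ B, MvPolynomial.map ι Q' = Q ∧
        Q.support ⊆ (MvPolynomial.map φ Q').support := by
    intro Q hQ
    have : Q ∈ Set.range (MvPolynomial.map ι) := by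
      rw [mem_range_map_iff_coeffs_subset]
      intro x hx
      obtain ⟨m, hm, rfl⟩ := mem_coeffs_iff.1 hx
      exact ⟨⟨_, hS _ (hQ m hm).1⟩, rfl⟩
    obtain ⟨Q', rfl⟩ := this
    refine ⟨Q', rfl, fun m hm => ?_⟩
    rw [mem_support_iff, coeff_map]
    have hunit : coeff m Q' * ⟨_, hS _ (hQ m hm).2⟩ = 1 := by
      apply hι
      rw [map_mul, map_one]
      rw [mem_support_iff, coeff_map] at hm
      change ι (coeff m Q') * (coeff m (MvPolynomial.map ι Q'))⁻¹ = 1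
      rw [coeff_map, mul_inv_cancel₀ hm]
    intro h0
    have := congrArg φ hunit
    rw [map_mul, h0, zero_mul, map_one] at this
    exact zero_ne_one this
  obtain ⟨Q', hQ', hQs⟩ := lift Q fun m hm => by
    constructor <;> simp only [S, Finset.mem_union, Finset.mem_image]
    · exact .inl (.inl ⟨m, hm, rfl⟩)
    · exact .inr (.inl ⟨m, hm, rfl⟩)
  obtain ⟨R', hR', hRs⟩ := lift R fun m hm => by
    constructor <;> simp only [S, Finset.mem_union, Finset.mem_image]
    · exact .inl (.inr ⟨m, hm, rfl⟩)
    · exact .inr (.inr ⟨m, hm, rfl⟩)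
  have hB : MvPolynomial.map (algebraMap K B) P = Q' * R' := by
    apply map_injective ι hι
    rw [map_mul, hQ', hR', ← hQR, MvPolynomial.map_map]
    rfl
  have hK : P = MvPolynomial.map φ Q' * MvPolynomial.map φ R' := by
    rw [← map_mul, ← hB, MvPolynomial.map_map, hφ, MvPolynomial.map_id]
  rcases hP _ _ hK with h | h
  · exact hne (h (hQs ha) (hQs ha'))
  · exact hne' (h (hRs hb) (hRs hb'))

/-! ### Reduction modulo a valuation at which the new coefficient vanishes -/

/-- Over a valuation ring, every nonzero polynomial can be rescaled to have integral coefficients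
and nonzero reduction. -/
theorem exists_primitive_scaling {F : Type*} [Field F] (V : ValuationSubring F)
    {Q : MvPolynomial σ F} (hQ : Q ≠ 0) :
    ∃ a : F, ∃ Q' : MvPolynomial σ V, MvPolynomial.map V.subtype Q' = C a * Q ∧
      MvPolynomial.map (IsLocalRing.residue V) Q' ≠ 0 ∧
      (MvPolynomial.map (IsLocalRing.residue V) Q').support ⊆ Q.support := by
  obtain ⟨m, hm, hmax⟩ := Finset.exists_max_image Q.support (fun m => V.valuation (coeff m Q))
    (support_nonempty.2 hQ)
  have hm0 : coeff m Q ≠ 0 := mem_support_iff.1 hm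
  have hmem : ∀ m', (coeff m Q)⁻¹ * coeff m' Q ∈ V := by
    intro m'
    by_cases hm' : m' ∈ Q.support
    · rw [← V.valuation_le_one_iff, map_mul, map_inv₀]
      refine (mul_le_mul_right (hmax m' hm') _).trans ?_
      rw [inv_mul_cancel₀ ((Valuation.ne_zero_iff _).2 hm0)]
    · rw [notMem_support_iff.1 hm', mul_zero]
      exact V.zero_mem
  have : C (coeff m Q)⁻¹ * Q ∈ Set.range (MvPolynomial.map V.subtype) := by
    rw [mem_range_map_iff_coeffs_subset]
    intro x hx
    obtain ⟨m', _, rfl⟩ := mem_coeffs_iff.1 hx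
    exact ⟨⟨_, hmem m'⟩, by rw [coeff_C_mul]; rfl⟩
  obtain ⟨Q', hQ'⟩ := this
  have hcoeff : ∀ m', ((coeff m' Q' : V) : F) = (coeff m Q)⁻¹ * coeff m' Q := fun m' => by
    rw [← coeff_C_mul, ← hQ', coeff_map]
    rfl
  refine ⟨_, Q', hQ', fun h0 => ?_, fun m' hm' => ?_⟩
  · have h1 : coeff m Q' = 1 := Subtype.ext (by rw [hcoeff, inv_mul_cancel₀ hm0]; rfl)
    have := congrArg (coeff m) h0
    rw [coeff_map, h1, map_one, coeff_zero] at this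
    exact one_ne_zero this
  · rw [mem_support_iff, coeff_map] at hm'
    rw [mem_support_iff]
    intro h0
    have h1 : coeff m' Q' = 0 := Subtype.ext (by rw [hcoeff, h0, mul_zero]; rfl)
    rw [h1, map_zero] at hm'
    exact hm' rfl

/-- If `c` is not invertible in `K[c]` (for instance, if it is transcendental over `K`), some
valuation subring contains `K` and has `c` in its maximal ideal. -/
theorem exists_valuationSubring_of_not_invertible {F : Type*} [Field F] [Algebra K F] {c : F}
    (hc : ∀ f : Polynomial K, Polynomial.aeval c f * c ≠ 1) :
    ∃ V : ValuationSubring F, (∀ x : K, algebraMap K F x ∈ V) ∧ c ∈ V.nonunits := by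
  let A : Subring F := (Polynomial.aeval c : Polynomial K →ₐ[K] F).toRingHom.range
  let cA : A := ⟨c, Polynomial.X, Polynomial.aeval_X c⟩
  have hI : Ideal.span {cA} ≠ ⊤ := by
    intro h
    obtain ⟨⟨_, f, rfl⟩, hy⟩ := Ideal.mem_span_singleton'.1 ((Ideal.eq_top_iff_one _).1 h)
    exact hc f (congrArg Subtype.val hy)
  obtain ⟨V, hA, hV⟩ := Ideal.image_subset_nonunits_valuationSubring _ hI
  exact ⟨V, fun x => hA ⟨Polynomial.C x, Polynomial.aeval_C c x⟩,
    hV ⟨cA, Ideal.subset_span rfl, rfl⟩⟩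

/-- Adding a term with a transcendental coefficient preserves having only monomial factors. Under
a valuation with `c` in the maximal ideal a factorization reduces to one of `P`. The hypothesis on
`c` says that `c` is not invertible in `K[c]`. -/
theorem OnlyMonomialFactors.map_add_monomial [IsAlgClosed K] {F : Type*} [Field F] [Algebra K F]
    {P : MvPolynomial σ K} (hP : OnlyMonomialFactors P) (hcol : ¬ ExponentsCollinear P.support)
    {k : σ →₀ ℕ} (hk : k ∉ P.support) {c : F}
    (hc : ∀ f : Polynomial K, Polynomial.aeval c f * c ≠ 1) :
    OnlyMonomialFactors (MvPolynomial.map (algebraMap K F) P + monomial k c) := by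
  classical
  intro Q R hQR
  obtain ⟨V, hKV, hcV⟩ := exists_valuationSubring_of_not_invertible hc
  obtain ⟨hcV, hcmax⟩ := ValuationSubring.mem_nonunits_iff_exists_mem_maximalIdeal.1 hcV
  let ι : K →+* V := (algebraMap K F).codRestrict V.toSubring hKV
  let κ := IsLocalRing.ResidueField V
  let _ : Algebra K κ := ((IsLocalRing.residue V).comp ι).toAlgebra
  obtain ⟨p, hp⟩ : P.support.Nonempty := by
    by_contra! h
    exact hcol (by rw [h]; intro i hi; simp at hi)
  have hpk : k ≠ p := fun h => hk (h ▸ hp)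
  have hp0 : coeff p P ≠ 0 := mem_support_iff.1 hp
  have hne : Q * R ≠ 0 := by
    rw [← hQR]
    intro h
    have := congrArg (coeff p) h
    rw [coeff_add, coeff_map, coeff_monomial, if_neg hpk, add_zero, coeff_zero,
      map_eq_zero] at this
    exact hp0 this
  obtain ⟨a, Q', hQ', hQ0, hQs⟩ := exists_primitive_scaling V (left_ne_zero_of_mul hne)
  obtain ⟨b, R', hR', hR0, hRs⟩ := exists_primitive_scaling V (right_ne_zero_of_mul hne)
  have hprod : MvPolynomial.map V.subtype (Q' * R') =
      C (a * b) * (MvPolynomial.map (algebraMap K F) P + monomial k c) := by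
    rw [map_mul, hQ', hR', hQR, C_mul]
    ring
  -- The scaling factor is integral, because a coefficient of `P` is a unit at `V`.
  have hab : ∃ v : V, (v : F) = a * b := by
    refine ⟨coeff p (Q' * R') * ι (coeff p P)⁻¹, ?_⟩
    have h1 : ((coeff p (Q' * R') : V) : F) = a * b * algebraMap K F (coeff p P) := by
      have := congrArg (coeff p) hprod
      rwa [coeff_map, coeff_C_mul, coeff_add, coeff_map, coeff_monomial, if_neg hpk,
        add_zero] at this
    change ((coeff p (Q' * R') : V) : F) * algebraMap K F (coeff p P)⁻¹ = a * b
    rw [h1, mul_assoc, ← map_mul, mul_inv_cancel₀ hp0, map_one, mul_one]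
  obtain ⟨v, hv⟩ := hab
  have hV : Q' * R' = C v * (MvPolynomial.map ι P + monomial k ⟨c, hcV⟩) := by
    apply map_injective V.subtype Subtype.val_injective
    rw [hprod, map_mul (MvPolynomial.map V.subtype), map_C, map_add, MvPolynomial.map_map, map_monomial, ← hv]
    rfl
  have hκ : MvPolynomial.map (IsLocalRing.residue V) Q' * MvPolynomial.map (IsLocalRing.residue V) R'
      = C (IsLocalRing.residue V v) * MvPolynomial.map (algebraMap K κ) P := by
    rw [← map_mul, hV, map_mul, map_C, map_add, MvPolynomial.map_map, map_monomial,
      (IsLocalRing.residue_eq_zero_iff _).2 hcmax, map_zero, add_zero]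
    rfl
  have hv0 : IsLocalRing.residue V v ≠ 0 := by
    intro h
    rw [h, map_zero, zero_mul] at hκ
    exact mul_ne_zero hQ0 hR0 hκ
  -- A factor whose reduction is a monomial is itself a monomial.
  have key : ∀ {Q R : MvPolynomial σ F} {Q₀ R₀ : MvPolynomial σ κ},
      MvPolynomial.map (algebraMap K F) P + monomial k c = Q * R →
      Q₀ * R₀ = C (IsLocalRing.residue V v) * MvPolynomial.map (algebraMap K κ) P →
      Q₀.support ⊆ Q.support → R₀ ≠ 0 → (R₀.support : Set (σ →₀ ℕ)).Subsingleton →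
      (R.support : Set (σ →₀ ℕ)).Subsingleton := by
    intro Q R Q₀ R₀ hQR hκ hQs hR0 hsub
    obtain ⟨r, hr⟩ := support_nonempty.2 hR0
    have hall : ∀ r' ∈ R.support, r' = r := by
      refine subsingleton_support_of_translate hcol (k := k) (Q := Q) ?_ ?_
      · intro m hm
        by_contra! hmne
        rw [← hQR, mem_support_iff, coeff_add, coeff_map, coeff_monomial, if_neg hmne.2.symm,
          notMem_support_iff.1 hmne.1, map_zero, add_zero] at hm
        exact hm rfl
      · intro j hj
        have h1 : j ∈ (Q₀ * R₀).support := by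
          rw [hκ, mem_support_iff, coeff_C_mul, coeff_map]
          exact mul_ne_zero hv0 ((map_ne_zero _).2 (mem_support_iff.1 hj))
        obtain ⟨x, hx, y, hy, hxy⟩ := Finset.mem_add.1 (support_mul Q₀ R₀ h1)
        exact ⟨x, hQs hx, by rw [← hxy, hsub hr hy]⟩
    intro x hx y hy
    rw [hall x hx, hall y hy]
  have hP' := (hP.map (F := κ)) (C (IsLocalRing.residue V v)⁻¹ *
    MvPolynomial.map (IsLocalRing.residue V) Q') (MvPolynomial.map (IsLocalRing.residue V) R') (by
      rw [mul_assoc, hκ, ← mul_assoc, ← C_mul, inv_mul_cancel₀ hv0, C_1, one_mul])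
  rcases hP' with h | h
  · left
    refine key (hQR.trans (mul_comm _ _)) ((mul_comm _ _).trans hκ) hRs hQ0 ?_
    rwa [C_mul', support_smul_eq (inv_ne_zero hv0)] at h
  · right
    exact key hQR hκ hQs hR0 h

/-! ### Choosing the new coefficient in the base field -/

theorem le_sup_support_of_mul {Q R : MvPolynomial σ K} (hR : R ≠ 0) {a : σ →₀ ℕ}
    (ha : a ∈ Q.support) : a ≤ (Q * R).support.sup id := by
  obtain ⟨b, hb⟩ := support_nonempty.2 hR
  intro t
  obtain ⟨c, hc, h⟩ := MvPolynomial.exists_mem_support_mul_le (exponentAt t) ha hb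
  have h1 : c ≤ (Q * R).support.sup id := Finset.le_sup (f := id) hc
  have h2 := h1 t
  simp only [exponentAt_apply] at h
  omega

/-- Some nonzero `c ∈ K` makes `P + c X^k` have only monomial factors. If every `c` failed, an
ultraproduct of the factorizations over an infinite set of values `c` would be a factorization
of `P + c X^k` with `c` transcendental over `K`. -/
theorem OnlyMonomialFactors.exists_add_monomial [IsAlgClosed K]
    {P : MvPolynomial σ K} (hP : OnlyMonomialFactors P) (hcol : ¬ ExponentsCollinear P.support)
    {k : σ →₀ ℕ} (hk : k ∉ P.support) :
    ∃ c : K, c ≠ 0 ∧ OnlyMonomialFactors (P + monomial k c) := by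
  classical
  by_contra! hcon
  have hcon' : ∀ c : {c : K // c ≠ 0}, ∃ Q R : MvPolynomial σ K, P + monomial k (c : K) = Q * R ∧
      (Q.support : Set (σ →₀ ℕ)).Nontrivial ∧ (R.support : Set (σ →₀ ℕ)).Nontrivial := by
    rintro ⟨c, hc⟩
    have := hcon c hc
    rw [OnlyMonomialFactors] at this
    push Not at this
    exact this
  choose Q R hQR hQ hR using hcon'
  choose a ha a' ha' haa using hQ
  choose b hb b' hb' hbb using hR
  obtain ⟨B, hB⟩ : ∃ B : σ →₀ ℕ, ∀ c, (∀ m ∈ (Q c).support, m ≤ B) ∧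
      ∀ m ∈ (R c).support, m ≤ B := by
    refine ⟨(insert k P.support).sup id, fun c => ?_⟩
    have hsub : (Q c * R c).support ⊆ insert k P.support := by
      rw [← hQR]
      intro m hm
      rw [Finset.mem_insert]
      by_contra! hne
      rw [mem_support_iff, coeff_add, coeff_monomial, if_neg hne.1.symm,
        notMem_support_iff.1 hne.2, add_zero] at hm
      exact hm rfl
    have hle := Finset.sup_mono (f := id) hsub
    constructor
    · intro m hm
      exact (le_sup_support_of_mul (ne_zero_iff.2 ⟨_, mem_support_iff.1 (hb c)⟩) hm).trans hle
    · intro m hm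
      rw [mul_comm] at hle
      exact (le_sup_support_of_mul (ne_zero_iff.2 ⟨_, mem_support_iff.1 (ha c)⟩) hm).trans hle
  have : Infinite {c : K // c ≠ 0} :=
    (Set.infinite_coe_iff (s := {c : K | c ≠ 0})).2 (Set.finite_singleton (0 : K)).infinite_compl
  let f : {c : K // c ≠ 0} → Finset.Iic B × Finset.Iic B × Finset.Iic B × Finset.Iic B := fun c =>
    (⟨a c, Finset.mem_Iic.2 ((hB c).1 _ (ha c))⟩, ⟨a' c, Finset.mem_Iic.2 ((hB c).1 _ (ha' c))⟩,
      ⟨b c, Finset.mem_Iic.2 ((hB c).2 _ (hb c))⟩, ⟨b' c, Finset.mem_Iic.2 ((hB c).2 _ (hb' c))⟩)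
  obtain ⟨⟨a₀, a₀', b₀, b₀'⟩, hinf⟩ := Finite.exists_infinite_fiber f
  let T := ↑(f ⁻¹' {(a₀, a₀', b₀, b₀')})
  have hT : ∀ c : T, a c = a₀ ∧ a' c = a₀' ∧ b c = b₀ ∧ b' c = b₀' := by
    rintro ⟨c, hc⟩
    have hc : f c = (a₀, a₀', b₀, b₀') := hc
    simp only [f, Prod.mk.injEq, Subtype.ext_iff] at hc
    exact hc
  let val : T → K := fun c => ((c : {c : K // c ≠ 0}) : K)
  have hval : Function.Injective val := Subtype.val_injective.comp Subtype.val_injective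
  let U : Filter T := Filter.hyperfilter T
  let F := Filter.Germ U K
  let germ : (T → K) →+* F := Filter.Germ.coeRingHom U
  have hgerm : ∀ g : T → K, (∀ c, g c ≠ 0) → germ g ≠ 0 := by
    intro g hg h
    have h1 : ∀ᶠ c in U, g c = 0 := Filter.Germ.coe_eq.1 h
    obtain ⟨c, hc⟩ := h1.exists
    exact hg c hc
  let const : K →+* (T → K) := Pi.constRingHom T K
  let _ : Algebra K F := (germ.comp const).toAlgebra
  -- The polynomial over the product ring `T → K` with components `Q c`.
  have bundle : ∀ Q : {c : K // c ≠ 0} → MvPolynomial σ K, (∀ c, ∀ m ∈ (Q c).support, m ≤ B) →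
      ∃ Q' : MvPolynomial σ (T → K), ∀ m (c : T), coeff m Q' c = coeff m (Q c) := by
    intro Q hQ
    refine ⟨∑ s ∈ Finset.Iic B, monomial s (fun c : T => coeff s (Q c)), fun m c => ?_⟩
    rw [coeff_sum]
    simp only [coeff_monomial]
    rw [Finset.sum_ite_eq']
    split_ifs with h
    · rfl
    · rw [Finset.mem_Iic] at h
      exact (notMem_support_iff.1 fun hm => h (hQ _ m hm)).symm
  obtain ⟨Q', hQ'⟩ := bundle Q fun c => (hB c).1
  obtain ⟨R', hR'⟩ := bundle R fun c => (hB c).2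
  have hprod : MvPolynomial.map const P + monomial k val = Q' * R' := by
    ext m : 1
    funext c
    have h1 : MvPolynomial.map (Pi.evalRingHom (fun _ => K) c) Q' = Q c :=
      MvPolynomial.ext _ _ fun m => by rw [coeff_map]; exact hQ' m c
    have h2 : MvPolynomial.map (Pi.evalRingHom (fun _ => K) c) R' = R c :=
      MvPolynomial.ext _ _ fun m => by rw [coeff_map]; exact hR' m c
    have h3 : coeff m (Q' * R') c = coeff m (Q c * R c) := by
      rw [← h1, ← h2, ← map_mul, coeff_map]
      rfl
    rw [h3, ← hQR, coeff_add, coeff_add, Pi.add_apply, coeff_map, coeff_monomial, coeff_monomial]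
    split_ifs <;> rfl
  have hF : MvPolynomial.map (algebraMap K F) P + monomial k (germ val) =
      MvPolynomial.map germ Q' * MvPolynomial.map germ R' := by
    rw [← map_mul, ← hprod, map_add, MvPolynomial.map_map, map_monomial]
    rfl
  have htrans : ∀ g : Polynomial K, Polynomial.aeval (germ val) g * germ val ≠ 1 := by
    intro g hg
    have h1 : Polynomial.aeval (germ val) g = germ fun c => g.eval (val c) := by
      have h2 : Polynomial.eval₂ const val g = fun c => g.eval (val c) := by
        funext c
        have := Polynomial.hom_eval₂ g const (Pi.evalRingHom (fun _ => K) c) val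
        exact this
      rw [← h2, Polynomial.hom_eval₂]
      rfl
    rw [h1, ← map_mul] at hg
    have h2 : ∀ᶠ c in U, g.eval (val c) * val c = 1 :=
      Filter.Germ.coe_eq.1 (hg.trans (map_one germ).symm)
    have hne : g * Polynomial.X - 1 ≠ 0 := by
      intro h
      have := congrArg (Polynomial.eval 0) h
      simp at this
    have hfin : {c : T | g.eval (val c) * val c = 1}.Finite := by
      refine Set.Finite.subset ((g * Polynomial.X - 1).roots.toFinset.finite_toSet.preimage
        hval.injOn) fun c hc => ?_
      have hc : g.eval (val c) * val c = 1 := hc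
      simp [hne, hc]
    exact Filter.notMem_hyperfilter_of_finite hfin h2
  have hmem : ∀ (Q : {c : K // c ≠ 0} → MvPolynomial σ K) (Q' : MvPolynomial σ (T → K)),
      (∀ m (c : T), coeff m Q' c = coeff m (Q c)) → ∀ m, (∀ c : T, m ∈ (Q c).support) →
      m ∈ (MvPolynomial.map germ Q').support := by
    intro Q Q' h m hm
    rw [mem_support_iff, coeff_map]
    refine hgerm _ fun c => ?_
    rw [h]
    exact mem_support_iff.1 (hm c)
  obtain ⟨c₀⟩ : Nonempty T := hinf.nonempty
  rcases hP.map_add_monomial hcol hk htrans _ _ hF with h | h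
  · apply haa c₀
    rw [(hT c₀).1, (hT c₀).2.1]
    exact h (hmem Q Q' hQ' _ fun c => (hT c).1 ▸ ha c) (hmem Q Q' hQ' _ fun c => (hT c).2.1 ▸ ha' c)
  · apply hbb c₀
    rw [(hT c₀).2.2.1, (hT c₀).2.2.2]
    exact h (hmem R R' hR' _ fun c => (hT c).2.2.1 ▸ hb c)
      (hmem R R' hR' _ fun c => (hT c).2.2.2 ▸ hb' c)

theorem ExponentsCollinear.mono {S T : Finset (σ →₀ ℕ)} (h : S ⊆ T) (hT : ExponentsCollinear T) :
    ExponentsCollinear S :=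
  fun i hi j hj k hk => hT i (h hi) j (h hj) k (h hk)

theorem OnlyMonomialFactors.exists_support_union [IsAlgClosed K] {P : MvPolynomial σ K}
    (hP : OnlyMonomialFactors P) (hcol : ¬ ExponentsCollinear P.support)
    {I : Finset (σ →₀ ℕ)} (hI : P.support ⊆ I) :
    ∃ P' : MvPolynomial σ K, P'.support = I ∧ OnlyMonomialFactors P' := by
  classical
  suffices ∀ S : Finset (σ →₀ ℕ), ∃ P' : MvPolynomial σ K,
      P'.support = P.support ∪ S ∧ OnlyMonomialFactors P' by
    obtain ⟨P', h, h'⟩ := this I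
    exact ⟨P', by rw [h, Finset.union_eq_right.2 hI], h'⟩
  intro S
  induction S using Finset.induction_on with
  | empty => exact ⟨P, by simp, hP⟩
  | insert k S _ ih =>
    obtain ⟨P', hs, hP'⟩ := ih
    by_cases hk : k ∈ P'.support
    · refine ⟨P', ?_, hP'⟩
      rw [Finset.union_insert, ← hs, Finset.insert_eq_of_mem hk]
    · obtain ⟨c, hc, h⟩ := hP'.exists_add_monomial
        (fun h => hcol (h.mono (by rw [hs]; exact Finset.subset_union_left))) hk
      refine ⟨_, ?_, h⟩
      rw [Finset.union_insert, ← hs]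
      ext m
      rw [mem_support_iff, coeff_add, coeff_monomial, Finset.mem_insert, mem_support_iff]
      by_cases hm : k = m
      · subst hm
        simp [notMem_support_iff.1 hk, hc]
      · simp [hm, Ne.symm hm]

/-- Every finite non-collinear set of exponents, not all congruent modulo the characteristic, is the
support of a polynomial with only monomial factors. -/
theorem exists_onlyMonomialFactors_of_not_collinear [IsAlgClosed K] {I : Finset (σ →₀ ℕ)}
    (hcol : ¬ ExponentsCollinear I) (hchar : ∃ i ∈ I, ∃ j ∈ I, ∃ t, (i t : K) ≠ j t) :
    ∃ P : MvPolynomial σ K, P.support = I ∧ OnlyMonomialFactors P := by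
  classical
  obtain ⟨i, hi, j, hj, t, ht⟩ := hchar
  have hij : (j t : ℤ) - i t ≠ 0 := by
    intro h
    have : i t = j t := by omega
    exact ht (by rw [this])
  -- Some point of `I` lies off the line through `i` and `j`.
  obtain ⟨k, hk, s, u, hsu⟩ : ∃ k ∈ I, ∃ s u,
      ((j s : ℤ) - i s) * ((k u : ℤ) - i u) ≠ ((j u : ℤ) - i u) * ((k s : ℤ) - i s) := by
    by_contra! h
    apply hcol
    intro x hx y hy z hz s u
    apply mul_left_cancel₀ (mul_ne_zero hij hij)
    have e : ∀ y ∈ I, ∀ s, ((j t : ℤ) - i t) * ((y s : ℤ) - x s) =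
        ((j s : ℤ) - i s) * ((y t : ℤ) - x t) := fun y hy s => by
      linear_combination h y hy t s - h x hx t s
    calc _ = (((j t : ℤ) - i t) * ((y s : ℤ) - x s)) * (((j t : ℤ) - i t) * ((z u : ℤ) - x u)) := by
          ring
      _ = (((j t : ℤ) - i t) * ((y u : ℤ) - x u)) * (((j t : ℤ) - i t) * ((z s : ℤ) - x s)) := by
          rw [e y hy s, e z hz u, e y hy u, e z hz s]
          ring
      _ = _ := by ring
  have hne1 : i ≠ j := fun h => ht (by rw [h])
  have hne2 : i ≠ k := by
    rintro rfl
    simp at hsu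
  have hne3 : j ≠ k := by
    rintro rfl
    exact hsu (mul_comm _ _)
  have hsupp : (monomial i (1 : K) - monomial j 1 + monomial k 1).support = {i, j, k} := by
    ext m
    rw [mem_support_iff, coeff_add, coeff_sub, coeff_monomial, coeff_monomial, coeff_monomial]
    simp only [Finset.mem_insert, Finset.mem_singleton]
    by_cases h1 : i = m
    · subst h1
      simp [hne1.symm, hne2.symm]
    · by_cases h2 : j = m
      · subst h2
        simp [h1, hne3.symm]
      · by_cases h3 : k = m
        · subst h3
          simp [h1, h2]
        · simp [h1, h2, h3, Ne.symm h1, Ne.symm h2, Ne.symm h3]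
  refine (onlyMonomialFactors_trinomial ht ⟨s, u, hsu⟩).exists_support_union ?_ ?_
  · rw [hsupp]
    intro h
    exact hsu (h i (by simp) j (by simp) k (by simp) s u)
  · rw [hsupp]
    intro m hm
    simp only [Finset.mem_insert, Finset.mem_singleton] at hm
    rcases hm with rfl | rfl | rfl <;> assumption

variable {n : ℕ}

/-! ### From monomial factors to irreducibility -/

theorem eq_C_of_subsingleton_support {σ : Type*} {Q R : MvPolynomial σ K} (h0 : Q * R ≠ 0)
    (hX : ∀ t, ∃ k ∈ (Q * R).support, k t = 0) (hQ : (Q.support : Set (σ →₀ ℕ)).Subsingleton) :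
    ∃ c, Q = C c := by
  classical
  obtain ⟨q, hq⟩ := support_nonempty.2 (left_ne_zero_of_mul h0)
  have hq0 : q = 0 := by
    ext t
    obtain ⟨k, hk, hkt⟩ := hX t
    obtain ⟨x, hx, y, -, rfl⟩ := Finset.mem_add.1 (support_mul Q R hk)
    rw [hQ hq hx]
    exact Nat.eq_zero_of_add_eq_zero_right hkt
  subst hq0
  refine ⟨coeff 0 Q, MvPolynomial.ext _ _ fun m => ?_⟩
  rw [coeff_C]
  split_ifs with h
  · rw [h]
  · by_contra hm
    exact h (hQ hq (mem_support_iff.2 hm))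

theorem OnlyMonomialFactors.not_isReduciblePoly {P : MvPolynomial (Fin n) K}
    (hP : OnlyMonomialFactors P) (h0 : P ≠ 0) (hX : ∀ t, ∃ k ∈ P.support, k t = 0) :
    ¬ IsReduciblePoly P := by
  rintro ⟨Q, R, hQ, hR, rfl⟩
  rcases hP Q R rfl with h | h
  · obtain ⟨c, hc⟩ := eq_C_of_subsingleton_support h0 hX h
    exact hQ c hc
  · rw [mul_comm] at h0 hX
    obtain ⟨c, hc⟩ := eq_C_of_subsingleton_support h0 hX h
    exact hR c hc

theorem not_isReduciblePoly_of_totalDegree_le_one {P : MvPolynomial (Fin n) K} (h0 : P ≠ 0)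
    (hP : P.totalDegree ≤ 1) : ¬ IsReduciblePoly P := by
  rintro ⟨Q, R, hQ, hR, rfl⟩
  rw [totalDegree_mul_of_isDomain (left_ne_zero_of_mul h0) (right_ne_zero_of_mul h0)] at hP
  have hQ' : Q.totalDegree ≠ 0 := fun h => hQ _ (totalDegree_eq_zero_iff_eq_C.1 h)
  have hR' : R.totalDegree ≠ 0 := fun h => hR _ (totalDegree_eq_zero_iff_eq_C.1 h)
  omega

/-! ### Collinear exponents -/

/-- The entries of a primitive pair of exponents with disjoint supports satisfy a Bezout
relation. -/
theorem exists_bezout_of_gcd_eq_one {a b : Fin n →₀ ℕ} (hab : ∀ t, a t * b t = 0)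
    (h : Nat.gcd (Finset.univ.gcd fun t => a t) (Finset.univ.gcd fun t => b t) = 1) :
    ∃ z : Fin n → ℤ, ∑ t, z t * ((b t : ℤ) - a t) = 1 := by
  rw [← Ideal.mem_span_range_iff_exists_fun, ← Ideal.eq_top_iff_one]
  obtain ⟨g, hg⟩ := (IsPrincipalIdealRing.principal
    (Ideal.span (Set.range fun t => (b t : ℤ) - a t))).principal
  have hdvd : ∀ t, g ∣ (b t : ℤ) - a t := fun t => by
    rw [← Ideal.mem_span_singleton, ← Ideal.submodule_span_eq, ← hg]
    exact Ideal.subset_span ⟨t, rfl⟩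
  have hb : ∀ t, g.natAbs ∣ a t ∧ g.natAbs ∣ b t := fun t => by
    have h1 := hdvd t
    rcases Nat.mul_eq_zero.1 (hab t) with h2 | h2
    · rw [h2, Nat.cast_zero, sub_zero] at h1
      exact ⟨h2 ▸ dvd_zero _, Int.natAbs_dvd_natAbs.2 h1⟩
    · rw [h2, Nat.cast_zero, zero_sub, dvd_neg] at h1
      exact ⟨Int.natAbs_dvd_natAbs.2 h1, h2 ▸ dvd_zero _⟩
  have hg1 : g.natAbs ∣ 1 := by
    rw [← h]
    exact Nat.dvd_gcd (Finset.dvd_gcd fun t _ => (hb t).1) (Finset.dvd_gcd fun t _ => (hb t).2)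
  rw [hg, Ideal.submodule_span_eq, Ideal.span_singleton_eq_top]
  exact Int.isUnit_iff_natAbs_eq.2 (Nat.dvd_one.1 hg1)

/-- An integer vector parallel to a primitive vector is an integer multiple of it. -/
theorem eq_mul_of_parallel_primitive {ι : Type*} [Fintype ι] {v w z : ι → ℤ}
    (hz : ∑ t, z t * v t = 1) (h : ∀ s t, w s * v t = w t * v s) (t : ι) :
    w t = (∑ s, z s * w s) * v t := by
  calc w t = w t * ∑ s, z s * v s := by rw [hz, mul_one]
    _ = _ := by
      rw [Finset.mul_sum, Finset.sum_mul]
      exact Finset.sum_congr rfl fun s _ => by linear_combination -(z s) * h s t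

/-- A nonzero collinear set of exponents meeting every coordinate hyperplane has end points `i`,
`j` with disjoint supports. The coordinate `t` parametrizes the line. -/
theorem exists_endpoints_of_collinear {I : Finset (Fin n →₀ ℕ)} (hI : I.Nonempty) (hI0 : I ≠ {0})
    (hcol : ExponentsCollinear I) (hX : ∀ t, ∃ k ∈ I, k t = 0) :
    ∃ i ∈ I, ∃ j ∈ I, (∀ s, i s * j s = 0) ∧ ∃ t, i t = 0 ∧ 0 < j t ∧ ∀ k ∈ I, k t ≤ j t := by
  obtain ⟨k₁, hk₁, t, ht⟩ : ∃ k ∈ I, ∃ t, k t ≠ 0 := by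
    by_contra! h
    refine hI0 (Finset.eq_singleton_iff_nonempty_unique_mem.2 ⟨hI, fun k hk => ?_⟩)
    exact Finsupp.ext fun t => h k hk t
  obtain ⟨i, hi, hit⟩ := hX t
  obtain ⟨j, hj, hmax⟩ := Finset.exists_max_image I (fun k => k t) hI
  have hjt : 0 < j t := (Nat.pos_of_ne_zero ht).trans_le (hmax k₁ hk₁)
  refine ⟨i, hi, j, hj, fun s => ?_, t, hit, hjt, hmax⟩
  obtain ⟨k, hk, hks⟩ := hX s
  have h1 := hcol i hi j hj k hk s t
  rw [hit, hks] at h1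
  have h2 : (j s : ℤ) * k t + i s * ((j t : ℤ) - k t) = 0 := by
    push_cast at h1
    linear_combination h1
  have h3 : (k t : ℤ) ≤ j t := by exact_mod_cast hmax k hk
  have h4 : (0 : ℤ) ≤ (j s : ℤ) * k t := by positivity
  have h5 : (0 : ℤ) ≤ i s * ((j t : ℤ) - k t) := mul_nonneg (by positivity) (by linarith)
  have h6 : (j s : ℤ) * k t = 0 := by linarith
  have h7 : (i s : ℤ) * ((j t : ℤ) - k t) = 0 := by linarith
  rcases mul_eq_zero.1 h6 with h8 | h8
  · rw [Nat.cast_eq_zero.1 h8, mul_zero]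
  · rw [h8, sub_zero] at h7
    rcases mul_eq_zero.1 h7 with h9 | h9
    · rw [Nat.cast_eq_zero.1 h9, zero_mul]
    · exact absurd (Nat.cast_eq_zero.1 h9) hjt.ne'

theorem mem_segment_of_collinear {I : Finset (Fin n →₀ ℕ)} (hcol : ExponentsCollinear I)
    {i j k : Fin n →₀ ℕ} (hi : i ∈ I) (hj : j ∈ I) (hk : k ∈ I) {t : Fin n} (hit : i t = 0)
    (hjt : 0 < j t) (hkt : k t ≤ j t) :
    exponentToReal k ∈ segment ℝ (exponentToReal i) (exponentToReal j) := by
  rw [segment_eq_image]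
  have hjt' : (0 : ℝ) < j t := by exact_mod_cast hjt
  have hkt' : (k t : ℝ) ≤ j t := by exact_mod_cast hkt
  refine ⟨(k t : ℝ) / j t, ⟨by positivity, (div_le_one hjt').2 hkt'⟩, funext fun s => ?_⟩
  have h1 := hcol i hi j hj k hk s t
  rw [hit] at h1
  have h2 : ((j s : ℝ) - i s) * k t = j t * ((k s : ℝ) - i s) := by
    have := congrArg (Int.cast : ℤ → ℝ) h1
    push_cast at this
    linear_combination this
  simp only [exponentToReal, Pi.add_apply, Pi.smul_apply, smul_eq_mul]
  field_simp
  linear_combination h2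

/-- A collinear set of exponents meeting every coordinate hyperplane, and not contained in a
segment as in the theorem, is a pair with primitive difference, hence the support of a
polynomial with only monomial factors. -/
theorem exists_onlyMonomialFactors_of_collinear {I : Finset (Fin n →₀ ℕ)}
    (hI : I.Nonempty) (hI0 : I ≠ {0}) (hcol : ExponentsCollinear I) (hX : ∀ t, ∃ k ∈ I, k t = 0)
    (hseg : ¬ ∃ i ∈ I, ∃ j ∈ I, (∀ t : Fin n, i t * j t = 0) ∧
      1 < Nat.gcd (Finset.univ.gcd fun t => i t) (Finset.univ.gcd fun t => j t) ∧
      ∀ k ∈ I, exponentToReal k ∈ segment ℝ (exponentToReal i) (exponentToReal j)) :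
    ∃ P : MvPolynomial (Fin n) K, P.support = I ∧ OnlyMonomialFactors P := by
  classical
  obtain ⟨i, hi, j, hj, hij, t, hit, hjt, hmax⟩ := exists_endpoints_of_collinear hI hI0 hcol hX
  have hgcd : Nat.gcd (Finset.univ.gcd fun t => i t) (Finset.univ.gcd fun t => j t) = 1 := by
    refine le_antisymm ?_ ?_
    · by_contra! h
      exact hseg ⟨i, hi, j, hj, hij, h, fun k hk =>
        mem_segment_of_collinear hcol hi hj hk hit hjt (hmax k hk)⟩
    · refine Nat.pos_of_ne_zero fun h => ?_
      have h1 : (Finset.univ.gcd fun t => j t) ∣ j t := Finset.gcd_dvd (Finset.mem_univ t)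
      rw [(Nat.gcd_eq_zero_iff.1 h).2] at h1
      exact hjt.ne' (zero_dvd_iff.1 h1)
  obtain ⟨z, hz⟩ := exists_bezout_of_gcd_eq_one hij hgcd
  have hIij : ∀ k ∈ I, k = i ∨ k = j := by
    intro k hk
    have hpar := eq_mul_of_parallel_primitive (v := fun t => (j t : ℤ) - i t)
      (w := fun t => (k t : ℤ) - i t) hz
      (fun s u => by linear_combination -hcol i hi j hj k hk s u)
    set m := ∑ s, z s * ((k s : ℤ) - i s)
    have h1 := hpar t
    simp only [hit, Nat.cast_zero, sub_zero] at h1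
    have h2 : (0 : ℤ) < j t := by exact_mod_cast hjt
    have h3 : (k t : ℤ) ≤ j t := by exact_mod_cast hmax k hk
    have h4 : 0 ≤ m := nonneg_of_mul_nonneg_left (by rw [← h1]; positivity) h2
    have h5 : m ≤ 1 := by nlinarith
    have h6 : m = 0 ∨ m = 1 := by omega
    rcases h6 with h6 | h6
    · left
      ext s
      have := hpar s
      simp only [h6] at this
      omega
    · right
      ext s
      have := hpar s
      simp only [h6] at this
      omega
  have hne : i ≠ j := by
    rintro rfl
    omega
  have hsupp : (monomial i (1 : K) + monomial j 1).support = I := by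
    ext m
    rw [mem_support_iff, coeff_add, coeff_monomial, coeff_monomial]
    by_cases h1 : i = m
    · subst h1
      simp [hne.symm, hi]
    · by_cases h2 : j = m
      · subst h2
        simp [hne, hj]
      · simp only [h1, h2, if_false, add_zero, ne_eq, not_true, false_iff]
        intro hm
        rcases hIij m hm with rfl | rfl
        · exact h1 rfl
        · exact h2 rfl
  refine ⟨_, hsupp, onlyMonomialFactors_of_primitive_binomial ?_ ?_ z hz⟩
  · rw [hsupp]
    exact hIij
  · rw [← support_nonempty, hsupp]
    exact hI

/-! ### The three families of supports all of whose polynomials are reducible -/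

theorem isReduciblePoly_of_support_subset_hyperplane {I : Finset (Fin n →₀ ℕ)} {t : Fin n}
    (hI : ∀ k ∈ I, ∃ m : Fin n →₀ ℕ, k = Finsupp.single t 1 + m) (hne : I ≠ {Finsupp.single t 1})
    {P : MvPolynomial (Fin n) K} (h0 : P ≠ 0) (hP : P.support = I) : IsReduciblePoly P := by
  classical
  have hdvd : X t ∣ P := by
    rw [← P.support_sum_monomial_coeff]
    refine Finset.dvd_sum fun k hk => ?_
    obtain ⟨m, hm⟩ := hI k (hP ▸ hk)
    refine ⟨monomial m (coeff k P), ?_⟩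
    rw [X, monomial_mul, one_mul, ← hm]
  obtain ⟨R, rfl⟩ := hdvd
  refine ⟨X t, R, fun c hc => ?_, fun c hc => ?_, rfl⟩
  · have := congrArg totalDegree hc
    rw [totalDegree_X, totalDegree_C] at this
    exact one_ne_zero this
  · apply hne
    subst hc
    rw [← hP, mul_comm, C_mul_X_eq_monomial, support_monomial, if_neg]
    rintro rfl
    simp at h0

theorem isReduciblePoly_of_support_subset_char_mul [IsAlgClosed K] {I : Finset (Fin n →₀ ℕ)}
    (hI : I.Nonempty) {p : ℕ} (hp : p.Prime) [CharP K p] (hne : I ≠ {0})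
    (hdiv : ∀ k ∈ I, ∃ m : Fin n →₀ ℕ, k = p • m)
    {P : MvPolynomial (Fin n) K} (hP : P.support = I) : IsReduciblePoly P := by
  classical
  have : Fact p.Prime := ⟨hp⟩
  choose! m hm using hdiv
  choose r hr using fun x : K => IsAlgClosed.exists_pow_nat_eq x hp.pos
  let Q : MvPolynomial (Fin n) K := ∑ k ∈ P.support, monomial (m k) (r (coeff k P))
  have hQ : P = Q ^ p := by
    rw [sum_pow_char]
    conv_lhs => rw [← P.support_sum_monomial_coeff]
    refine Finset.sum_congr rfl fun k hk => ?_
    rw [monomial_pow, hr, ← hm k (hP ▸ hk)]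
  have hconst : ∀ c, P ≠ C c := by
    intro c hc
    refine hne (Finset.eq_singleton_iff_nonempty_unique_mem.2 ⟨hI, fun k hk => ?_⟩)
    rw [← hP, hc, mem_support_iff, coeff_C] at hk
    by_contra h
    exact hk (if_neg (Ne.symm h))
  have hQc : ∀ c, Q ≠ C c := fun c hc => hconst (c ^ p) (by rw [hQ, hc, C_pow])
  refine ⟨Q, Q ^ (p - 1), hQc, fun c hc => ?_, by
    rw [← pow_succ', Nat.sub_add_cancel hp.one_le, hQ]⟩
  have hQ0 : Q ≠ 0 := by simpa using hQc 0
  have h1 := congrArg totalDegree hc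
  rw [show p - 1 = p - 2 + 1 by have := hp.two_le; omega, pow_succ,
    totalDegree_mul_of_isDomain (pow_ne_zero _ hQ0) hQ0, totalDegree_C] at h1
  exact hQc _ (totalDegree_eq_zero_iff_eq_C.1 (Nat.eq_zero_of_add_eq_zero_left h1))

/-- A binary form of degree `d ≥ 2` in two monomials `X^a`, `X^b` splits off a linear form. -/
theorem isReduciblePoly_of_binary_form [IsAlgClosed K] {a b : Fin n →₀ ℕ}
    (hab : ∀ t, a t * b t = 0) (hne : a ≠ b) {d : ℕ} (hd : 1 < d) {P : MvPolynomial (Fin n) K}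
    (hP : ∀ k ∈ P.support, ∃ m ≤ d, k = m • b + (d - m) • a) (ha : d • a ∈ P.support)
    (hb : d • b ∈ P.support) : IsReduciblePoly P := by
  classical
  choose! M hMd hM using hP
  obtain ⟨t, ht⟩ : ∃ t, a t ≠ b t := by
    by_contra! h
    exact hne (Finsupp.ext h)
  have hMuniq : ∀ m ≤ d, ∀ m' ≤ d, m • b + (d - m) • a = m' • b + (d - m') • a → m = m' := by
    intro m hm m' hm' h
    have h1 := congrArg (fun k => ((k t : ℕ) : ℤ)) h
    simp only [Finsupp.add_apply, Finsupp.smul_apply, smul_eq_mul] at h1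
    push_cast [hm, hm'] at h1
    have h2 : ((b t : ℤ) - a t) ≠ 0 := sub_ne_zero.2 (by exact_mod_cast ht.symm)
    have h3 : (m : ℤ) = m' := mul_right_cancel₀ h2 (by linear_combination h1)
    exact_mod_cast h3
  have hM0 : M (d • a) = 0 :=
    hMuniq _ (hMd _ ha) _ (Nat.zero_le d) (by rw [← hM _ ha]; simp)
  have hMdb : M (d • b) = d := hMuniq _ (hMd _ hb) _ le_rfl (by rw [← hM _ hb]; simp)
  -- The dehomogenization of `P`.
  let f : Polynomial K := ∑ k ∈ P.support, Polynomial.monomial (M k) (coeff k P)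
  have hfcoeff : ∀ k ∈ P.support, f.coeff (M k) = coeff k P := by
    intro k hk
    simp only [f, Polynomial.finsetSum_coeff, Polynomial.coeff_monomial]
    rw [Finset.sum_eq_single k, if_pos rfl]
    · intro k' hk' hne
      refine if_neg fun h => hne ?_
      rw [hM k hk, hM k' hk', h]
    · exact fun h => absurd hk h
  have hfdeg : f.natDegree ≤ d := Polynomial.natDegree_sum_le_of_forall_le _ _ fun k hk =>
    (Polynomial.natDegree_monomial_le _).trans (hMd k hk)
  have hf0 : f.coeff 0 ≠ 0 := by
    have := hfcoeff _ ha
    rw [hM0] at this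
    rw [this]
    exact mem_support_iff.1 ha
  have hfd : f.coeff d ≠ 0 := by
    have := hfcoeff _ hb
    rw [hMdb] at this
    rw [this]
    exact mem_support_iff.1 hb
  obtain ⟨r, hr⟩ := IsAlgClosed.exists_root f fun h => hfd
    (Polynomial.coeff_eq_zero_of_degree_lt (by rw [h]; exact_mod_cast (by omega : 0 < d)))
  obtain ⟨g, hg⟩ := Polynomial.dvd_iff_isRoot.2 hr
  have hr0 : r ≠ 0 := by
    rintro rfl
    rw [hg] at hf0
    simp at hf0
  have hgdeg : g.natDegree ≤ d - 1 := by
    have hg0 : g ≠ 0 := by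
      rintro rfl
      simp [hg] at hf0
    rw [hg, Polynomial.natDegree_mul (Polynomial.X_sub_C_ne_zero r) hg0,
      Polynomial.natDegree_X_sub_C] at hfdeg
    omega
  let Ψ : MvPolynomial (Fin 2) K →ₐ[K] MvPolynomial (Fin n) K :=
    aeval ![monomial b 1, monomial a 1]
  have hΨ : P = Ψ (f.homogenize d) := by
    simp only [f]
    rw [Polynomial.homogenize_finsetSum, map_sum]
    conv_lhs => rw [← P.support_sum_monomial_coeff]
    refine Finset.sum_congr rfl fun k hk => ?_
    rw [Polynomial.homogenize_monomial (hMd k hk), aeval_monomial, Finsupp.prod_fintype _ _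
      (by simp), Fin.prod_univ_two]
    simp only [Finsupp.coe_update, Function.update, Finsupp.single_apply]
    simp [monomial_pow, monomial_mul, algebraMap_eq, C_mul_monomial, ← hM k hk]
  have hfac : P = (monomial b 1 - monomial a r) * Ψ (g.homogenize (d - 1)) := by
    have h1 : Ψ ((Polynomial.X - Polynomial.C r).homogenize 1) = monomial b 1 - monomial a r := by
      rw [sub_eq_add_neg, ← Polynomial.C_neg, Polynomial.homogenize_add,
        Polynomial.homogenize_X one_ne_zero, Polynomial.homogenize_C, map_add, map_mul, map_mul]
      simp [Ψ, algebraMap_eq, C_mul_monomial, sub_eq_add_neg]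
    have h2 : d = 1 + (d - 1) := by omega
    rw [← h1, ← map_mul, ← Polynomial.homogenize_mul _ _ (Polynomial.natDegree_X_sub_C r).le hgdeg,
      ← h2, ← hg]
    exact hΨ
  refine ⟨_, _, fun c hc => ?_, fun c hc => ?_, hfac⟩
  · by_cases hb0 : b = 0
    · have h1 := congrArg (coeff a) hc
      rw [coeff_sub, coeff_monomial, coeff_monomial, coeff_C, if_neg hne.symm, if_pos rfl,
        if_neg fun h => hne (h.symm.trans hb0.symm), zero_sub, neg_eq_zero] at h1
      exact hr0 h1
    · have h1 := congrArg (coeff b) hc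
      rw [coeff_sub, coeff_monomial, coeff_monomial, coeff_C, if_neg hne, if_pos rfl,
        if_neg (Ne.symm hb0), sub_zero] at h1
      exact one_ne_zero h1
  · -- Otherwise the support of `P` would be contained in `{a, b}`, but it contains `d a` and `d b`.
    have hsub : ∀ k ∈ P.support, k = a ∨ k = b := by
      intro k hk
      by_contra! h
      rw [hfac, hc, mul_comm, mem_support_iff, coeff_C_mul, coeff_sub, coeff_monomial,
        coeff_monomial, if_neg h.1.symm, if_neg h.2.symm, sub_zero, mul_zero] at hk
      exact hk rfl
    have hA : ∀ {a b : Fin n →₀ ℕ}, a t * b t = 0 → a t ≠ 0 → d • a = a ∨ d • a = b → False := by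
      intro a b hab ha h
      have hb : b t = 0 := (Nat.mul_eq_zero.1 hab).resolve_left ha
      rcases h with h | h <;> have h1 := congrArg (fun k => k t) h <;>
        simp only [Finsupp.smul_apply, smul_eq_mul] at h1
      · exact hd.ne' (mul_right_cancel₀ ha (by rw [h1, one_mul]))
      · rw [hb] at h1
        exact (mul_ne_zero (by omega) ha) h1
    by_cases h : a t = 0
    · exact hA (by rw [mul_comm]; exact hab t) (fun h' => ht (by rw [h, h']))
        (hsub _ hb).symm
    · exact hA (hab t) h (hsub _ ha)

theorem isReduciblePoly_of_support_subset_segment [IsAlgClosed K] {i j : Fin n →₀ ℕ}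
    (hij : ∀ t, i t * j t = 0)
    (hgcd : 1 < Nat.gcd (Finset.univ.gcd fun t => i t) (Finset.univ.gcd fun t => j t))
    {P : MvPolynomial (Fin n) K} (hi : i ∈ P.support) (hj : j ∈ P.support)
    (hseg : ∀ k ∈ P.support, exponentToReal k ∈ segment ℝ (exponentToReal i) (exponentToReal j)) :
    IsReduciblePoly P := by
  obtain ⟨d, hd⟩ : ∃ d, d = Nat.gcd (Finset.univ.gcd fun t => i t) (Finset.univ.gcd fun t => j t) :=
    ⟨_, rfl⟩
  rw [← hd] at hgcd
  have hd0 : 0 < d := by omega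
  have hdi : ∀ t, d ∣ i t := fun t => hd ▸
    (Nat.gcd_dvd_left _ _).trans (Finset.gcd_dvd (Finset.mem_univ t))
  have hdj : ∀ t, d ∣ j t := fun t => hd ▸
    (Nat.gcd_dvd_right _ _).trans (Finset.gcd_dvd (Finset.mem_univ t))
  obtain ⟨a, rfl⟩ : ∃ a : Fin n →₀ ℕ, i = d • a := by
    choose a ha using hdi
    exact ⟨Finsupp.equivFunOnFinite.symm a, Finsupp.ext fun t => by simp [ha t]⟩
  obtain ⟨b, rfl⟩ : ∃ b : Fin n →₀ ℕ, j = d • b := by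
    choose b hb using hdj
    exact ⟨Finsupp.equivFunOnFinite.symm b, Finsupp.ext fun t => by simp [hb t]⟩
  simp only [Finsupp.smul_apply, smul_eq_mul] at hij hd
  have hab : ∀ t, a t * b t = 0 := by
    intro t
    have := hij t
    rcases Nat.mul_eq_zero.1 this with h | h <;>
      rcases Nat.mul_eq_zero.1 h with h | h <;> first | omega | simp [h]
  have hgcd1 : Nat.gcd (Finset.univ.gcd fun t => a t) (Finset.univ.gcd fun t => b t) = 1 := by
    rw [Finset.gcd_mul_left, Finset.gcd_mul_left, normalize_eq, Nat.gcd_mul_left] at hd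
    exact (mul_left_cancel₀ hd0.ne' (by rw [← hd, mul_one]))
  obtain ⟨z, hz⟩ := exists_bezout_of_gcd_eq_one hab hgcd1
  obtain ⟨t, ht⟩ : ∃ t, (b t : ℤ) - a t ≠ 0 := by
    by_contra! h
    simp [h] at hz
  have hne : a ≠ b := by
    rintro rfl
    simp at ht
  refine isReduciblePoly_of_binary_form hab hne hgcd (fun k hk => ?_) hi hj
  have hk := hseg k hk
  rw [segment_eq_image] at hk
  obtain ⟨θ, ⟨hθ0, hθ1⟩, hθ⟩ := hk
  have hθs : ∀ s, (k s : ℝ) - d * a s = θ * d * (b s - a s) := by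
    intro s
    have := congrFun hθ s
    simp only [exponentToReal, Pi.add_apply, Pi.smul_apply, smul_eq_mul, Finsupp.smul_apply,
      Nat.cast_mul] at this
    linear_combination -this
  have hpar := eq_mul_of_parallel_primitive (v := fun t => (b t : ℤ) - a t)
    (w := fun t => (k t : ℤ) - d * a t) hz (fun s u => by
      have : (((k s : ℝ) - d * a s) * (b u - a u)) = ((k u : ℝ) - d * a u) * (b s - a s) := by
        rw [hθs, hθs]
        ring
      exact_mod_cast this)
  set m := ∑ s, z s * ((k s : ℤ) - d * a s)
  have hmθ : (m : ℝ) = θ * d := by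
    have ht' : ((b t : ℝ) - a t) ≠ 0 := by exact_mod_cast ht
    refine mul_right_cancel₀ ht' ?_
    rw [← hθs]
    have h1 := congrArg (Int.cast : ℤ → ℝ) (hpar t)
    push_cast at h1
    exact h1.symm
  have hm0 : 0 ≤ m := by
    have : (0 : ℝ) ≤ m := by
      rw [hmθ]
      positivity
    exact_mod_cast this
  have hmd : m ≤ d := by
    have : (m : ℝ) ≤ d := by
      rw [hmθ]
      exact mul_le_of_le_one_left (by positivity) hθ1
    exact_mod_cast this
  clear_value m
  lift m to ℕ using hm0
  have hmd' : m ≤ d := by exact_mod_cast hmd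
  refine ⟨m, hmd', Finsupp.ext fun s => ?_⟩
  have h1 := hpar s
  have h2 : (m • b + (d - m) • a) s = m * b s + (d - m) * a s := rfl
  rw [h2]
  zify [hmd']
  linear_combination h1

end

/-! ### The classification -/

theorem theorem1p3 {K : Type*} [Field K] [IsAlgClosed K] (n : ℕ) (hn : 1 ≤ n)
    (I : Finset (Fin n →₀ ℕ)) (hI : I.Nonempty) :
    reduciblePolysWithSupport K I = polysWithSupport K I ↔
      (∃ t : Fin n,
          (∀ k ∈ I, ∃ m : Fin n →₀ ℕ, k = Finsupp.single t 1 + m) ∧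
          I ≠ {Finsupp.single t 1}) ∨
      (∃ i ∈ I, ∃ j ∈ I,
          (∀ t : Fin n, i t * j t = 0) ∧
          1 < Nat.gcd (Finset.univ.gcd fun t => i t) (Finset.univ.gcd fun t => j t) ∧
          ∀ k ∈ I, exponentToReal k ∈ segment ℝ (exponentToReal i) (exponentToReal j)) ∨
      (∃ p : ℕ, p.Prime ∧ CharP K p ∧ I ≠ {0} ∧
          ∀ k ∈ I, ∃ m : Fin n →₀ ℕ, k = p • m) := by
  classical
  constructor
  · intro hall
    have hred : ∀ P : MvPolynomial (Fin n) K, P.support = I → IsReduciblePoly P := fun P hP =>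
      (hall.symm ▸ (show P ∈ polysWithSupport K I from hP) :
        P ∈ reduciblePolysWithSupport K I).2
    by_contra! hcon
    obtain ⟨hi, hii, hiii⟩ := hcon
    have hsupp : ∀ s : Fin n →₀ ℕ, (monomial s (1 : K)).support = {s} := fun s => by
      rw [support_monomial, if_neg one_ne_zero]
    have hnz : ∀ s : Fin n →₀ ℕ, (monomial s (1 : K)) ≠ 0 := fun s => by
      rw [← support_nonempty, hsupp]
      exact Finset.singleton_nonempty s
    by_cases hI0 : I = {0}
    · refine not_isReduciblePoly_of_totalDegree_le_one (hnz 0) ?_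
        (hred (monomial 0 1) ((hsupp 0).trans hI0.symm))
      rw [totalDegree_monomial _ one_ne_zero]
      simp
    by_cases hI1 : ∃ t, I = {Finsupp.single t 1}
    · obtain ⟨t, ht⟩ := hI1
      refine not_isReduciblePoly_of_totalDegree_le_one (hnz (Finsupp.single t 1)) ?_
        (hred _ ((hsupp _).trans ht.symm))
      rw [totalDegree_monomial _ one_ne_zero]
      simp
    push Not at hI1
    have hX : ∀ t, ∃ k ∈ I, k t = 0 := by
      intro t
      by_contra! h
      refine hI1 t (hi t fun k hk => ⟨k - Finsupp.single t 1, ?_⟩)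
      rw [add_tsub_cancel_of_le]
      rw [Finsupp.single_le_iff]
      exact Nat.one_le_iff_ne_zero.2 (h k hk)
    obtain ⟨P, hP, hPm⟩ : ∃ P : MvPolynomial (Fin n) K, P.support = I ∧ OnlyMonomialFactors P := by
      by_cases hcol : ExponentsCollinear I
      · refine exists_onlyMonomialFactors_of_collinear hI hI0 hcol hX ?_
        rintro ⟨i, hi, j, hj, h1, h2, h3⟩
        obtain ⟨k, hk, hk'⟩ := hii i hi j hj h1 h2
        exact hk' (h3 k hk)
      · refine exists_onlyMonomialFactors_of_not_collinear hcol ?_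
        -- Otherwise all exponents vanish in `K`, as each coordinate vanishes somewhere on `I`.
        by_contra! hchar
        have hzero : ∀ k ∈ I, ∀ t, ((k t : ℕ) : K) = 0 := by
          intro k hk t
          obtain ⟨l, hl, hlt⟩ := hX t
          rw [hchar k hk l hl t, hlt, Nat.cast_zero]
        obtain ⟨p, hp⟩ := CharP.exists K
        rcases CharP.char_is_prime_or_zero K p with hpp | hp0
        · obtain ⟨k, hk, hk'⟩ := hiii p hpp hp hI0
          have hdvd : ∀ t, p ∣ k t := fun t => (CharP.cast_eq_zero_iff K p _).1 (hzero k hk t)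
          choose m hm using hdvd
          exact hk' (Finsupp.equivFunOnFinite.symm m) (Finsupp.ext fun t => by simp [hm t])
        · subst hp0
          refine hI0 (Finset.eq_singleton_iff_nonempty_unique_mem.2 ⟨hI, fun k hk => ?_⟩)
          refine Finsupp.ext fun t => ?_
          have := (CharP.cast_eq_zero_iff K 0 _).1 (hzero k hk t)
          exact zero_dvd_iff.1 this
    refine hPm.not_isReduciblePoly ?_ ?_ (hred P hP)
    · rw [← support_nonempty, hP]
      exact hI
    · rwa [hP]
  · intro h
    refine Set.Subset.antisymm (fun P hP => hP.1) fun P hP => ⟨hP, ?_⟩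
    have hP : P.support = I := hP
    have h0 : P ≠ 0 := by
      rw [← support_nonempty, hP]
      exact hI
    rcases h with ⟨t, h1, h2⟩ | ⟨i, hi, j, hj, h1, h2, h3⟩ | ⟨p, hp, hchar, h1, h2⟩
    · exact isReduciblePoly_of_support_subset_hyperplane h1 h2 h0 hP
    · subst hP
      exact isReduciblePoly_of_support_subset_segment h1 h2 hi hj h3
    · exact isReduciblePoly_of_support_subset_char_mul hI hp h1 h2 hP
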